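/- Let $K$ be a field, let $n\ge 4$, and let $S=K[x_1,\dots,x_n]$ be the polynomial ring with its standard grading. Let $G$ be a simple graph with vertex set $\{1,\dots,n\}$ and edge set $E(G)$, and let $$I_c(G)=\Bigl(\tfrac{x_1\cdots x_n}{x_ix_j} : \{i,j\}\in E(G)\Bigr)\subseteq S$$ be its complementary edge ideal. Then $I_c(G)$ has a minimal graded free resolution with terms of finite rank, and the graded Betti numbers $\beta_{i,j}(I_c(G))$ (the number of copies of $S(-j)$ in the $i$-th term of a minimal graded free resolution of $I_c(G)$, where the terms are numbered from $i=0$) satisfy $$\beta_{i,j}(I_c(G))\neq 0\ \Longrightarrow\ (i,j)\in\{(0,n-2),\,(1,n-1),\,(1,n),\,(2,n)\}.$$ If moreover $G$ has no isolated vertices, then the projective dimension and the Castelnuovo–Mumford regularity $\operatorname{reg}(I_c(G))=\max\{j-i : \beta_{i,j}(I_c(G))\neq 0\}$ satisfy $$1\le \operatorname{pd}(I_c(G))\le 2,\qquad n-2\le \operatorname{reg}(I_c(G))\le n-1 .$$ -/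

import Mathlib

open MvPolynomial

/-- The complementary edge ideal of a graph `G` on `n` vertices: the ideal of `K[x_1, …, x_n]`
generated by the products of all variables except `x_i` and `x_j`, for the edges `{i, j}`. -/
noncomputable def complementaryEdgeIdeal (K : Type*) [Field K] {n : ℕ}
    (G : SimpleGraph (Fin n)) : Ideal (MvPolynomial (Fin n) K) :=
  Ideal.span {u | ∃ i j : Fin n, G.Adj i j ∧ u = ∏ k ∈ ({i, j} : Finset (Fin n))ᶜ, X k}

/-- A minimal graded free resolution `⋯ → F_2 → F_1 → F_0 → I → 0` of an ideal `I` of the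
standard graded polynomial ring `S = K[x_1, …, x_n]`. The module `F_i` is free on a finite
homogeneous basis `e_1, …, e_r`, where `r = rank i` and `e_a` has degree `deg i a`; that is,
`F_i = ⨁ₐ S(-deg i a)`. -/
structure MinimalGradedFreeResolution {K : Type*} [Field K] {n : ℕ}
    (I : Ideal (MvPolynomial (Fin n) K)) where
  /-- the rank of `F_i` -/
  rank : ℕ → ℕ
  /-- the degrees of the basis elements of `F_i` -/
  deg : (i : ℕ) → Fin (rank i) → ℕ
  /-- the augmentation `F_0 → S`, with image `I` -/
  aug : (Fin (rank 0) → MvPolynomial (Fin n) K) →ₗ[MvPolynomial (Fin n) K]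
    MvPolynomial (Fin n) K
  /-- the differential `F_{i+1} → F_i` -/
  d : (i : ℕ) → (Fin (rank (i + 1)) → MvPolynomial (Fin n) K) →ₗ[MvPolynomial (Fin n) K]
    (Fin (rank i) → MvPolynomial (Fin n) K)
  /-- the augmentation is homogeneous of degree `0` -/
  aug_homogeneous : ∀ b, (aug (Pi.single b 1)).IsHomogeneous (deg 0 b)
  /-- the differentials are homogeneous of degree `0`: a nonzero matrix entry in row `a` and
  column `b` is homogeneous of degree `deg i a` less than `deg (i + 1) b` -/
  d_homogeneous : ∀ i a b, d i (Pi.single b 1) a ≠ 0 →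
    ∃ k, deg i a + k = deg (i + 1) b ∧ (d i (Pi.single b 1) a).IsHomogeneous k
  /-- the image of the augmentation is `I` -/
  range_aug : LinearMap.range aug = I
  /-- exactness at `F_0` -/
  exact_zero : Function.Exact (d 0) aug
  /-- exactness at `F_{i+1}` -/
  exact_succ : ∀ i, Function.Exact (d (i + 1)) (d i)
  /-- minimality: the image of `F_{i+1}` lies in `(x_1, …, x_n) F_i`, i.e. the entries of the
  matrices of the differentials have zero constant term -/
  minimal : ∀ i a b, constantCoeff (d i (Pi.single b 1) a) = 0

namespace MinimalGradedFreeResolution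

variable {K : Type*} [Field K] {n : ℕ} {I : Ideal (MvPolynomial (Fin n) K)}

/-- The graded Betti number `β_{i,j}(I)`, read off a minimal graded free resolution of `I`: the
number of copies of `S(-j)` in `F_i`. -/
def betti (F : MinimalGradedFreeResolution I) (i j : ℕ) : ℕ :=
  Fintype.card {a : Fin (F.rank i) // F.deg i a = j}

/-- `r` is the Castelnuovo–Mumford regularity of `I`: `r = max {j - i : β_{i,j}(I) ≠ 0}`. -/
def IsRegularity (F : MinimalGradedFreeResolution I) (r : ℤ) : Prop :=
  IsGreatest {s : ℤ | ∃ i j : ℕ, F.betti i j ≠ 0 ∧ s = (j : ℤ) - (i : ℤ)} r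

end MinimalGradedFreeResolution

/-!
An ideal `I` generated by squarefree monomials has a minimal resolution that is graded by exponent
vectors. Irredundant multihomogeneous generators of a kernel have coefficients without constant
terms in every relation, and the kernel of a map of free modules with squarefree multidegrees is
again generated in squarefree multidegrees: a vector homogeneous of degree `u` is divisible by the
excess of `u` over its squarefree part. Hence all degrees in this resolution are at most `n`.

Comparison maps between two minimal resolutions are mutually inverse modulo `(x_1, …, x_n)`, so the
same degrees occur in all of them. Minimality makes the degrees increase strictly along the
resolution, so if the generators have degree `d`, then `β_{i,j}(I) ≠ 0` forces `d + i ≤ j ≤ n`, and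
`j = d` for `i = 0`. For complementary edge ideals `d = n - 2`.

If `I` were projective and contained two monomials `m ≠ m'` of degree `d`, a variable `x` occurring
to a higher power in `m` than in `m'` could be cancelled from `m` inside `I`, giving an element of
degree `d - 1`.
-/

/-! ### Graded free modules -/

section GradedVectors

variable {σ R ι κ Γ : Type*} [CommSemiring R] [AddCommMonoid Γ]

/-- The part of a polynomial supported on a set `A` of exponents. -/
noncomputable def supportedPart (A : Set (σ →₀ ℕ)) : MvPolynomial σ R →ₗ[R] MvPolynomial σ R :=
  open Classical in
  (basisMonomials σ R).constr R fun d => if d ∈ A then monomial d 1 else 0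

theorem coeff_supportedPart (A : Set (σ →₀ ℕ)) [DecidablePred (· ∈ A)] (p : MvPolynomial σ R)
    (d : σ →₀ ℕ) : coeff d (supportedPart A p) = if d ∈ A then coeff d p else 0 := by
  classical
  induction p using MvPolynomial.induction_on' with
  | monomial e r =>
    have h : (monomial e r : MvPolynomial σ R) = r • basisMonomials σ R e := by
      simp [smul_monomial]
    rw [supportedPart, h, map_smul, Module.Basis.constr_basis, ← h]
    by_cases he : e ∈ A <;> by_cases hed : e = d <;> simp_all [coeff_monomial]
  | add p q hp hq => rw [map_add, coeff_add, hp, hq, coeff_add]; split_ifs <;> simp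

/-- Homogeneous elements of degree `t` of the graded free module `⨁ₐ S(-δ a)`, for the grading of
`S = R[x_i : i ∈ σ]` in which the monomial with exponent `d` has degree `φ d`. The standard grading
is `φ = Finsupp.degree`, the grading by exponents is `φ = AddMonoidHom.id _`. -/
def IsHomogeneousVector (φ : (σ →₀ ℕ) →+ Γ) (δ : ι → Γ) (t : Γ) (f : ι → MvPolynomial σ R) :
    Prop :=
  ∀ a d, coeff d (f a) ≠ 0 → δ a + φ d = t

/-- The projection of `⨁ₐ S(-δ a)` onto its homogeneous elements of degree `t`. -/
noncomputable def vectorComponent (φ : (σ →₀ ℕ) →+ Γ) (δ : ι → Γ) (t : Γ) :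
    (ι → MvPolynomial σ R) →ₗ[R] (ι → MvPolynomial σ R) :=
  LinearMap.pi fun a => supportedPart {d | δ a + φ d = t} ∘ₗ LinearMap.proj a

/-- Linear maps `⨁_b S(-δ b) → ⨁ₐ S(-ε a)` that are homogeneous of degree `0`. -/
def IsGradedMap [DecidableEq ι] (φ : (σ →₀ ℕ) →+ Γ) (δ : ι → Γ) (ε : κ → Γ)
    (g : (ι → MvPolynomial σ R) →ₗ[MvPolynomial σ R] (κ → MvPolynomial σ R)) : Prop :=
  ∀ b, IsHomogeneousVector φ ε (δ b) (g (Pi.single b 1))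

variable {φ : (σ →₀ ℕ) →+ Γ} {δ : ι → Γ} {ε : κ → Γ} {t : Γ}

theorem coeff_vectorComponent [DecidableEq Γ] (f : ι → MvPolynomial σ R) (a : ι) (d : σ →₀ ℕ) :
    coeff d (vectorComponent φ δ t f a) = if δ a + φ d = t then coeff d (f a) else 0 := by
  classical
  exact (coeff_supportedPart _ _ _).trans (by rfl)

theorem isHomogeneousVector_vectorComponent (f : ι → MvPolynomial σ R) :
    IsHomogeneousVector φ δ t (vectorComponent φ δ t f) := by
  classical
  intro a d h
  rw [coeff_vectorComponent] at h
  exact (ite_ne_right_iff.1 h).1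

theorem IsHomogeneousVector.vectorComponent_eq {f : ι → MvPolynomial σ R}
    (hf : IsHomogeneousVector φ δ t f) : vectorComponent φ δ t f = f := by
  classical
  ext a d
  rw [coeff_vectorComponent, ite_eq_left_iff]
  exact fun h => (not_imp_comm.1 (hf a d) h).symm

theorem IsHomogeneousVector.vectorComponent_smul {s : Γ} {f : ι → MvPolynomial σ R}
    (hf : IsHomogeneousVector φ δ s f) (p : MvPolynomial σ R) :
    vectorComponent φ δ t (p • f) = supportedPart {d | s + φ d = t} p • f := by
  classical
  ext a d
  simp only [coeff_vectorComponent, Pi.smul_apply, smul_eq_mul, coeff_mul, coeff_supportedPart,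
    Finset.ite_sum_zero, ite_mul, zero_mul, Set.mem_ofPred_eq]
  refine Finset.sum_congr rfl fun ⟨x, y⟩ hxy => ?_
  by_cases hy : coeff y (f a) = 0
  · simp only [hy, mul_zero, ite_self]
  · have hdeg : s + φ x = δ a + φ d := by
      rw [← hf a y hy, ← Finset.HasAntidiagonal.mem_antidiagonal.1 hxy, map_add, add_right_comm,
        add_assoc]
    rw [hdeg]

theorem mem_span_range_vectorComponent [Finite ι] (φ : (σ →₀ ℕ) →+ Γ) (δ : ι → Γ)
    (f : ι → MvPolynomial σ R) :
    f ∈ Submodule.span R (Set.range fun t => vectorComponent φ δ t f) := by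
  classical
  have := Fintype.ofFinite ι
  let T := Finset.univ.biUnion fun a => (f a).support.image fun d => δ a + φ d
  suffices f = ∑ t ∈ T, vectorComponent φ δ t f from
    this ▸ Submodule.sum_mem _ fun t _ => Submodule.subset_span ⟨t, by rw [← this]⟩
  ext a d
  simp only [Finset.sum_apply, coeff_sum, coeff_vectorComponent, Finset.sum_ite_eq]
  rw [eq_comm, ite_eq_left_iff, eq_comm]
  refine not_imp_comm.1 fun hd => ?_
  exact Finset.mem_biUnion.2
    ⟨a, Finset.mem_univ a, Finset.mem_image_of_mem _ (mem_support_iff.2 hd)⟩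

theorem map_eq_sum_single {S M : Type*} [Semiring S] [AddCommMonoid M] [Module S M]
    [Fintype ι] [DecidableEq ι] (g : (ι → S) →ₗ[S] M) (f : ι → S) :
    g f = ∑ b, f b • g (Pi.single b 1) := by
  conv_lhs => rw [pi_eq_sum_univ' f, map_sum]
  simp only [map_smul]

theorem IsGradedMap.vectorComponent_map [Finite ι] [DecidableEq ι]
    {g : (ι → MvPolynomial σ R) →ₗ[MvPolynomial σ R] (κ → MvPolynomial σ R)}
    (hg : IsGradedMap φ δ ε g) (f : ι → MvPolynomial σ R) :
    vectorComponent φ ε t (g f) = g (vectorComponent φ δ t f) := by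
  have := Fintype.ofFinite ι
  rw [map_eq_sum_single g f, map_eq_sum_single g (vectorComponent φ δ t f), map_sum]
  exact Finset.sum_congr rfl fun b _ => (hg b).vectorComponent_smul (f b)

end GradedVectors

theorem exists_irredundant_generators {S M : Type*} [Semiring S] [AddCommMonoid M] [Module S M]
    {T : Set M} (hT : (Submodule.span S T).FG) :
    ∃ (r : ℕ) (g : Fin r → M), (∀ a, g a ∈ T) ∧ Submodule.span S (Set.range g) = .span S T ∧
      ∀ a, g a ∉ Submodule.span S (g '' {a}ᶜ) := by
  classical
  have hfin : ∃ (r : ℕ) (g : Fin r → M), (∀ a, g a ∈ T) ∧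
      Submodule.span S (Set.range g) = .span S T := by
    obtain ⟨s, hsT, hs⟩ := (Submodule.fg_span_iff_fg_span_finset_subset T).1 hT
    refine ⟨s.card, fun a => s.equivFin.symm a, fun a => hsT (s.equivFin.symm a).2, ?_⟩
    rw [hs, ← Function.comp_def, s.equivFin.symm.surjective.range_comp, Subtype.range_coe]
  obtain ⟨g, hgT, hg⟩ := Nat.find_spec hfin
  refine ⟨Nat.find hfin, g, hgT, hg, fun a ha => ?_⟩
  obtain ⟨r, hr⟩ := Nat.exists_eq_succ_of_ne_zero (Fin.pos a).ne'
  have hmin := Nat.find_min hfin (m := r) (by omega)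
  generalize Nat.find hfin = m at *
  subst hr
  refine hmin ⟨g ∘ a.succAbove, fun b => hgT _, ?_⟩
  rw [Set.range_comp, Fin.range_succAbove, ← hg, ← Submodule.span_insert_eq_span ha,
    ← Set.image_insert_eq, Set.insert_eq, Set.union_compl_self, Set.image_univ]

theorem supportedPart_singleton_zero {σ R : Type*} [CommSemiring R] (p : MvPolynomial σ R) :
    supportedPart {0} p = C (constantCoeff p) := by
  classical
  ext d
  rw [coeff_supportedPart, coeff_C]
  by_cases h : d = 0 <;> simp [h, constantCoeff_eq, eq_comm]

theorem constantCoeff_eq_zero_of_sum_smul_eq_zero {σ K Γ ι : Type*} {r : ℕ} [Field K]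
    [AddCommMonoid Γ] [IsLeftCancelAdd Γ] {φ : (σ →₀ ℕ) →+ Γ} (hφ : ∀ d, φ d = 0 → d = 0)
    {δ : ι → Γ} {u : Fin r → Γ}
    {g : Fin r → ι → MvPolynomial σ K} (hg : ∀ a, IsHomogeneousVector φ δ (u a) (g a))
    (hirr : ∀ a, g a ∉ Submodule.span (MvPolynomial σ K) (g '' {a}ᶜ))
    {c : Fin r → MvPolynomial σ K} (hc : ∑ a, c a • g a = 0) (a : Fin r) :
    constantCoeff (c a) = 0 := by
  classical
  by_contra hca
  let c' := fun b => supportedPart {d | u b + φ d = u a} (c b)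
  have hc' : ∑ b, c' b • g b = 0 := by
    simpa only [map_sum, map_zero, (hg _).vectorComponent_smul] using
      congrArg (vectorComponent φ δ (u a)) hc
  have hset : {d | u a + φ d = u a} = {0} :=
    Set.ext fun d => add_eq_left.trans ⟨hφ d, fun h => h ▸ map_zero φ⟩
  have hunit : IsUnit (c' a) := by
    rw [show c' a = C (constantCoeff (c a)) by rw [← supportedPart_singleton_zero, ← hset]]
    exact (IsUnit.mk0 _ hca).map C
  refine hirr a ((Submodule.smul_mem_iff_of_isUnit _ hunit).1 ?_)
  rw [← Finset.add_sum_erase _ _ (Finset.mem_univ a)] at hc'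
  rw [eq_neg_of_add_eq_zero_left hc']
  refine Submodule.neg_mem _ (Submodule.sum_mem _ fun b hb => Submodule.smul_mem _ _ ?_)
  exact Submodule.subset_span ⟨b, Finset.ne_of_mem_erase hb, rfl⟩

theorem IsHomogeneousVector.exists_monomial_smul {σ R ι : Type*} [CommSemiring R] {δ : ι → σ →₀ ℕ}
    (hδ : ∀ a k, δ a k ≤ 1) {u : σ →₀ ℕ} {f : ι → MvPolynomial σ R}
    (hf : IsHomogeneousVector (.id _) δ u f) :
    ∃ (v e : σ →₀ ℕ) (f' : ι → MvPolynomial σ R), (∀ k, v k ≤ 1) ∧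
      IsHomogeneousVector (.id _) δ v f' ∧ f = monomial e (1 : R) • f' := by
  let v := u.mapRange (min 1) (by simp)
  let e := u - v
  have hev : e + v = u := tsub_add_cancel_of_le fun k => min_le_right 1 (u k)
  refine ⟨v, e, fun a => (f a).divMonomial e, fun k => min_le_left 1 (u k), fun a d hd => ?_,
    funext fun a => ?_⟩
  · rw [coeff_divMonomial] at hd
    refine add_left_cancel (a := e) ?_
    rw [hev, ← hf a _ hd]
    exact add_left_comm _ _ _
  · have hle : ∀ d, coeff d (f a) ≠ 0 → e ≤ d := fun d hd k => by
      have h₁ : δ a k + d k = u k := DFunLike.congr_fun (hf a d hd) k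
      have h₂ : e k = u k - min 1 (u k) := rfl
      have h₃ := hδ a k
      omega
    ext d
    rw [Pi.smul_apply, smul_eq_mul, coeff_monomial_mul', one_mul, coeff_divMonomial]
    split_ifs with hd
    · rw [add_tsub_cancel_of_le hd]
    · exact not_imp_comm.1 (hle d) hd

theorem IsGradedMap.ker_eq_span_squarefree {σ R ι κ : Type*} [CommRing R] [IsDomain R] [Finite ι]
    [DecidableEq ι] {δ : ι → σ →₀ ℕ} (hδ : ∀ a k, δ a k ≤ 1) {ε : κ → σ →₀ ℕ}
    {g : (ι → MvPolynomial σ R) →ₗ[MvPolynomial σ R] (κ → MvPolynomial σ R)}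
    (hg : IsGradedMap (.id _) δ ε g) :
    LinearMap.ker g = Submodule.span (MvPolynomial σ R)
      {f | g f = 0 ∧ ∃ u : σ →₀ ℕ, (∀ k, u k ≤ 1) ∧ IsHomogeneousVector (.id _) δ u f} := by
  refine le_antisymm (fun f hf => ?_) (Submodule.span_le.2 fun f hf => hf.1)
  refine (Submodule.span_le (p := (Submodule.span (MvPolynomial σ R) _).restrictScalars R)).2 ?_
    (mem_span_range_vectorComponent (.id _) δ f)
  rintro _ ⟨t, rfl⟩
  obtain ⟨v, e, f', hv, hf', he⟩ :=
    (isHomogeneousVector_vectorComponent (φ := .id _) (δ := δ) (t := t) f).exists_monomial_smul hδ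
  have hker : monomial e (1 : R) • g f' = 0 := by
    rw [← map_smul, ← he, ← hg.vectorComponent_map, hf, map_zero]
  have hgf' : g f' = 0 := (smul_eq_zero.1 hker).resolve_left (by simp)
  change vectorComponent _ _ t f ∈ Submodule.span _ _
  exact he ▸ Submodule.smul_mem _ _ (Submodule.subset_span ⟨hgf', v, hv, hf'⟩)

/-! ### Multigraded resolutions -/

/-- A submodule of a free module of finite rank with basis elements in squarefree multidegrees,
given by multihomogeneous generators in squarefree multidegrees. -/
structure SquarefreeSubmodule (K σ : Type*) [Field K] where
  /-- the rank of the free module -/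
  rank : ℕ
  /-- the multidegrees of the basis elements -/
  deg : Fin rank → σ →₀ ℕ
  deg_le_one : ∀ a k, deg a k ≤ 1
  /-- the generators -/
  gens : Set (Fin rank → MvPolynomial σ K)
  gens_homogeneous : ∀ f ∈ gens, ∃ u : σ →₀ ℕ,
    (∀ k, u k ≤ 1) ∧ IsHomogeneousVector (.id _) deg u f

/-- The ideal generated by the monomials with exponents in `A`. -/
noncomputable def monomialIdeal (R : Type*) {σ : Type*} [CommSemiring R] (A : Set (σ →₀ ℕ)) :
    Ideal (MvPolynomial σ R) :=
  Ideal.span ((fun u => monomial u 1) '' A)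

namespace SquarefreeSubmodule

variable {K σ : Type*} [Field K]

/-- `d` is a minimal multigraded presentation of the submodule `N` with module of relations `M`. -/
structure IsMinimalCover (N M : SquarefreeSubmodule K σ)
    (d : (Fin M.rank → MvPolynomial σ K) →ₗ[MvPolynomial σ K] (Fin N.rank → MvPolynomial σ K)) :
    Prop where
  isGradedMap : IsGradedMap (.id _) M.deg N.deg d
  single_mem_gens : ∀ b, d (Pi.single b 1) ∈ N.gens
  range_eq : LinearMap.range d = Submodule.span _ N.gens
  ker_eq : LinearMap.ker d = Submodule.span _ M.gens
  constantCoeff_eq_zero : ∀ f, d f = 0 → ∀ a, constantCoeff (f a) = 0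

/-- The ideal generated by the monomials with exponents in `A`, as a submodule of the free module
of rank `1`. -/
noncomputable def ofExponents (K : Type*) [Field K] {A : Set (σ →₀ ℕ)}
    (hA : ∀ u ∈ A, ∀ k, u k ≤ 1) : SquarefreeSubmodule K σ where
  rank := 1
  deg := 0
  deg_le_one _ _ := zero_le_one
  gens := (fun u _ => monomial u 1) '' A
  gens_homogeneous := by
    classical
    rintro _ ⟨u, hu, rfl⟩
    refine ⟨u, hA u hu, fun a d hd => (zero_add d).trans ?_⟩
    rw [coeff_monomial] at hd
    exact (ite_ne_right_iff.1 hd).1.symm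

theorem exists_isMinimalCover [Finite σ] (N : SquarefreeSubmodule K σ) :
    ∃ M d, IsMinimalCover N M d := by
  obtain ⟨r, g, hgN, hspan, hirr⟩ := exists_irredundant_generators
    (IsNoetherian.noetherian (Submodule.span (MvPolynomial σ K) N.gens))
  choose u hu hg using fun a => N.gens_homogeneous _ (hgN a)
  let d := Fintype.linearCombination (MvPolynomial σ K) g
  have hd : ∀ b, d (Pi.single b 1) = g b := fun b => by
    rw [Fintype.linearCombination_apply_single, one_smul]
  have hgraded : IsGradedMap (.id _) u N.deg d := fun b => hd b ▸ hg b
  exact ⟨⟨r, u, hu, _, fun f hf => hf.2⟩, d, hgraded, fun b => hd b ▸ hgN b,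
    (Fintype.range_linearCombination _ g).trans hspan, hgraded.ker_eq_span_squarefree hu,
    fun f hf => constantCoeff_eq_zero_of_sum_smul_eq_zero (fun _ h => h) hg hirr hf⟩

theorem exists_augmentation [Finite σ] {A : Set (σ →₀ ℕ)} (hA : ∀ u ∈ A, ∀ k, u k ≤ 1) :
    ∃ (M : SquarefreeSubmodule K σ)
      (ε : (Fin M.rank → MvPolynomial σ K) →ₗ[MvPolynomial σ K] MvPolynomial σ K),
      (∀ b, M.deg b ∈ A ∧ ε (Pi.single b 1) = monomial (M.deg b) 1) ∧
      LinearMap.range ε = monomialIdeal K A ∧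
      LinearMap.ker ε = Submodule.span _ M.gens ∧
      ∀ f, ε f = 0 → ∀ a, constantCoeff (f a) = 0 := by
  classical
  obtain ⟨M, d, hd⟩ := (ofExponents K hA).exists_isMinimalCover
  let d' : (Fin M.rank → MvPolynomial σ K) →ₗ[MvPolynomial σ K] (Fin 1 → MvPolynomial σ K) := d
  let e := LinearEquiv.funUnique (Fin 1) (MvPolynomial σ K) (MvPolynomial σ K)
  have he : ∀ f, e (d' f) = 0 ↔ d f = 0 := fun f => e.map_eq_zero_iff
  refine ⟨M, e ∘ₗ d', fun b => ?_, ?_, ?_, fun f hf => hd.constantCoeff_eq_zero f ((he f).1 hf)⟩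
  · obtain ⟨u, hu, h⟩ := hd.single_mem_gens b
    have hdeg := hd.isGradedMap b (0 : Fin 1) u
    rw [← h, coeff_monomial, if_pos rfl] at hdeg
    obtain rfl : M.deg b = u := (hdeg one_ne_zero).symm.trans (zero_add u)
    exact ⟨hu, (congrFun h (0 : Fin 1)).symm⟩
  · rw [LinearMap.range_comp]
    exact (congrArg _ hd.range_eq).trans ((Submodule.map_span _ _).trans
      (congrArg _ (Set.image_image _ _ _)))
  · rw [← hd.ker_eq]
    exact Submodule.ext he

end SquarefreeSubmodule

theorem IsHomogeneousVector.degree_iff {σ R ι : Type*} [CommSemiring R] {δ : ι → ℕ} {t : ℕ}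
    {f : ι → MvPolynomial σ R} : IsHomogeneousVector Finsupp.degree δ t f ↔
      ∀ a, f a ≠ 0 → ∃ k, δ a + k = t ∧ (f a).IsHomogeneous k := by
  refine ⟨fun hf a ha => ?_, fun hf a d hd => ?_⟩
  · obtain ⟨d, hd⟩ := exists_coeff_ne_zero ha
    refine ⟨d.degree, hf a d hd, fun e he => ?_⟩
    have := hf a e he
    have := hf a d hd
    rw [Pi.one_def, ← Finsupp.degree_eq_weight_one]
    omega
  · obtain ⟨k, rfl, hk⟩ := hf a fun h => hd (by rw [h, coeff_zero])
    rw [← hk hd, Finsupp.degree_eq_weight_one]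
    rfl

theorem IsHomogeneousVector.degree {σ R ι : Type*} [CommSemiring R] {δ : ι → σ →₀ ℕ}
    {u : σ →₀ ℕ} {f : ι → MvPolynomial σ R} (hf : IsHomogeneousVector (.id _) δ u f) :
    IsHomogeneousVector Finsupp.degree (fun a => (δ a).degree) u.degree f := fun a d hd => by
  rw [← hf a d hd, map_add]
  rfl

theorem degree_le_card_of_le_one {σ : Type*} [Fintype σ] {u : σ →₀ ℕ} (hu : ∀ k, u k ≤ 1) :
    u.degree ≤ Fintype.card σ := by
  rw [Finsupp.degree_eq_sum]
  exact (Finset.sum_le_card_nsmul _ _ 1 fun k _ => hu k).trans (by simp)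

namespace MinimalGradedFreeResolution

theorem exists_deg_le_of_squarefree {K : Type*} [Field K] {n : ℕ} {A : Set (Fin n →₀ ℕ)}
    (hA : ∀ u ∈ A, ∀ k, u k ≤ 1) :
    ∃ P : MinimalGradedFreeResolution (monomialIdeal K A),
      (∀ i b, P.deg i b ≤ n) ∧ ∀ b, ∃ u ∈ A, P.deg 0 b = u.degree := by
  obtain ⟨M, ε, hM, hrange, hker, hmin⟩ := SquarefreeSubmodule.exists_augmentation (K := K) hA
  choose next d hd using SquarefreeSubmodule.exists_isMinimalCover (K := K) (σ := Fin n)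
  let N : ℕ → SquarefreeSubmodule K (Fin n) := fun i => i.rec M fun _ => next
  have hN : ∀ i, (N i).IsMinimalCover (N (i + 1)) (d (N i)) := fun i => hd (N i)
  have hexact₀ : Function.Exact (d M) ε :=
    LinearMap.exact_iff.2 (hker.trans (hN 0).range_eq.symm)
  have hexact : ∀ i, Function.Exact (d (N (i + 1))) (d (N i)) := fun i =>
    LinearMap.exact_iff.2 ((hN i).ker_eq.trans (hN (i + 1)).range_eq.symm)
  let P : MinimalGradedFreeResolution (monomialIdeal K A) :=
    { rank := fun i => (N i).rank
      deg := fun i b => ((N i).deg b).degree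
      aug := ε
      d := fun i => d (N i)
      aug_homogeneous := fun b => (hM b).2 ▸ isHomogeneous_monomial 1 rfl
      d_homogeneous := fun i a b => IsHomogeneousVector.degree_iff.1 ((hN i).isGradedMap b).degree a
      range_aug := hrange
      exact_zero := hexact₀
      exact_succ := hexact
      minimal := fun i => by
        intro a b
        cases i with
        | zero => exact hmin _ ((hexact₀ _).2 ⟨_, rfl⟩) a
        | succ i => exact (hN i).constantCoeff_eq_zero _ ((hexact i _).2 ⟨_, rfl⟩) a }
  refine ⟨P, fun i b => ?_, fun b => ⟨_, (hM b).1, rfl⟩⟩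
  exact (degree_le_card_of_le_one ((N i).deg_le_one b)).trans (Fintype.card_fin n).le

end MinimalGradedFreeResolution

/-! ### Comparison of minimal resolutions -/

theorem mem_smul_top_pi_iff {S ι : Type*} [CommSemiring S] [Finite ι] {J : Ideal S} {x : ι → S} :
    x ∈ J • (⊤ : Submodule S (ι → S)) ↔ ∀ a, x a ∈ J := by
  classical
  have := Fintype.ofFinite ι
  refine ⟨fun hx a => ?_, fun hx => ?_⟩
  · refine (Submodule.smul_le.2 ?_ : J • ⊤ ≤ Submodule.comap (LinearMap.proj (R := S) a) J) hx
    exact fun r hr y _ => J.mul_mem_right (y a) hr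
  · rw [pi_eq_sum_univ' x]
    exact Submodule.sum_mem _ fun a _ => Submodule.smul_mem_smul (hx a) trivial

section Comparison

variable {S M N M' N' : Type*} [CommRing S] [AddCommGroup M] [Module S M] [AddCommGroup N]
  [Module S N] [AddCommGroup M'] [Module S M'] [AddCommGroup N'] [Module S N'] {J : Ideal S}

/-- The components `α` and `β` of two comparison maps between complexes in one degree, where `Z`
and `W` are the modules of boundaries: on `Z`, the composition `β ∘ α` is the identity up to a
map `h` into `Z`, which sends `Z` into `J Z`. -/
structure IsHomotopyInverseOn (J : Ideal S) (Z : Submodule S M) (W : Submodule S N)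
    (α : M →ₗ[S] N) (β : N →ₗ[S] M) : Prop where
  map_le : Z.map α ≤ W
  map_le' : W.map β ≤ Z
  exists_homotopy : ∃ h : M →ₗ[S] M, LinearMap.range h ≤ Z ∧ Z.map h ≤ J • Z ∧
    ∀ x ∈ Z, β (α x) + h x = x

theorem exists_comp_eq_of_range_le {P : Type*} [AddCommGroup P] [Module S P] [Module.Projective S P]
    {p : N →ₗ[S] M} {g : P →ₗ[S] M} (h : LinearMap.range g ≤ LinearMap.range p) :
    ∃ l : P →ₗ[S] N, p ∘ₗ l = g := by
  obtain ⟨l, hl⟩ := Module.projective_lifting_property p.rangeRestrict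
    (g.codRestrict _ fun x => h ⟨x, rfl⟩) p.surjective_rangeRestrict
  exact ⟨l, congrArg ((LinearMap.range p).subtype ∘ₗ ·) hl⟩

variable {f : M' →ₗ[S] M} {p : N' →ₗ[S] N} {α : M →ₗ[S] N} {β : N →ₗ[S] M}
  {α' : M' →ₗ[S] N'} {β' : N' →ₗ[S] M'}

theorem IsHomotopyInverseOn.sub_mem_smul_top
    (H : IsHomotopyInverseOn J (LinearMap.range f) (LinearMap.range p) α β)
    (hα : p ∘ₗ α' = α ∘ₗ f) (hβ : f ∘ₗ β' = β ∘ₗ p) (hf : LinearMap.ker f ≤ J • ⊤) (x : M') :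
    x - β' (α' x) ∈ J • (⊤ : Submodule S M') := by
  obtain ⟨h, -, hJ, hid⟩ := H.exists_homotopy
  have hx : f (x - β' (α' x)) = h (f x) := by
    rw [map_sub, ← LinearMap.comp_apply f, hβ, LinearMap.comp_apply, ← LinearMap.comp_apply p, hα,
      LinearMap.comp_apply, sub_eq_iff_eq_add', hid _ ⟨x, rfl⟩]
  obtain ⟨y, hy, hyx⟩ : f (x - β' (α' x)) ∈ (J • (⊤ : Submodule S M')).map f := by
    rw [hx, Submodule.map_smul'', Submodule.map_top]
    exact hJ ⟨f x, ⟨x, rfl⟩, rfl⟩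
  have hker : x - β' (α' x) - y ∈ LinearMap.ker f := by
    rw [LinearMap.mem_ker, map_sub, hyx, sub_self]
  exact (Submodule.sub_mem_iff_left _ hy).1 (hf hker)

theorem IsHomotopyInverseOn.lift [Module.Projective S M]
    (H : IsHomotopyInverseOn J (LinearMap.range f) (LinearMap.range p) α β)
    (hα : p ∘ₗ α' = α ∘ₗ f) (hβ : f ∘ₗ β' = β ∘ₗ p) (hf : LinearMap.ker f ≤ J • ⊤) :
    IsHomotopyInverseOn J (LinearMap.ker f) (LinearMap.ker p) α' β' := by
  obtain ⟨h, hrange, -, hid⟩ := H.exists_homotopy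
  obtain ⟨k, hk⟩ := exists_comp_eq_of_range_le hrange
  have hα' : ∀ x, p (α' x) = α (f x) := LinearMap.congr_fun hα
  have hβ' : ∀ y, f (β' y) = β (p y) := LinearMap.congr_fun hβ
  have hk' : ∀ x, f (k x) = h x := LinearMap.congr_fun hk
  let h' : M' →ₗ[S] M' := LinearMap.id - β' ∘ₗ α' - k ∘ₗ f
  have hh' : ∀ x, h' x = x - β' (α' x) - k (f x) := fun x => rfl
  have hrange' : LinearMap.range h' ≤ LinearMap.ker f := by
    rintro _ ⟨x, rfl⟩
    rw [LinearMap.mem_ker, hh', map_sub, map_sub, hβ', hα', hk', sub_sub, hid _ ⟨x, rfl⟩, sub_self]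
  refine ⟨?_, ?_, h', hrange', ?_, fun x hx => ?_⟩
  · rintro _ ⟨x, hx, rfl⟩
    rw [LinearMap.mem_ker, hα', LinearMap.mem_ker.1 hx, map_zero]
  · rintro _ ⟨y, hy, rfl⟩
    rw [LinearMap.mem_ker, hβ', LinearMap.mem_ker.1 hy, map_zero]
  · calc (LinearMap.ker f).map h' ≤ (J • ⊤ : Submodule S M').map h' := Submodule.map_mono hf
      _ = J • LinearMap.range h' := by rw [Submodule.map_smul'', Submodule.map_top]
      _ ≤ J • LinearMap.ker f := smul_mono_right J hrange'
  · rw [hh', LinearMap.mem_ker.1 hx, map_zero, sub_zero, add_sub_cancel]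

end Comparison

section GradedComparison

variable {σ R Γ ι κ ι' κ' : Type*} [CommRing R] [AddCommMonoid Γ] [DecidableEq ι] [DecidableEq ι']
  [DecidableEq κ'] {φ : (σ →₀ ℕ) →+ Γ} {δ : ι → Γ} {ε : κ → Γ} {δ' : ι' → Γ} {ε' : κ' → Γ}
  {f : (ι' → MvPolynomial σ R) →ₗ[MvPolynomial σ R] (ι → MvPolynomial σ R)}
  {p : (κ' → MvPolynomial σ R) →ₗ[MvPolynomial σ R] (κ → MvPolynomial σ R)}
  {α : (ι → MvPolynomial σ R) →ₗ[MvPolynomial σ R] (κ → MvPolynomial σ R)}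
  {β : (κ → MvPolynomial σ R) →ₗ[MvPolynomial σ R] (ι → MvPolynomial σ R)}
  {J : Ideal (MvPolynomial σ R)}

theorem IsGradedMap.comp [Finite ι] (hα : IsGradedMap φ δ ε α) (hf : IsGradedMap φ δ' δ f) :
    IsGradedMap φ δ' ε (α ∘ₗ f) := fun b => by
  rw [LinearMap.comp_apply, ← (hf b).vectorComponent_eq, ← hα.vectorComponent_map]
  exact isHomogeneousVector_vectorComponent _

theorem IsGradedMap.exists_lift [Finite ι] [Finite κ']
    (hα : IsGradedMap φ δ ε α) (hp : IsGradedMap φ ε' ε p)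
    (h : LinearMap.range α ≤ LinearMap.range p) : ∃ l, IsGradedMap φ δ ε' l ∧ p ∘ₗ l = α := by
  have := Fintype.ofFinite ι
  choose y hy using fun b => h ⟨Pi.single b 1, rfl⟩
  let l := Fintype.linearCombination (MvPolynomial σ R) fun b => vectorComponent φ ε' (δ b) (y b)
  have hl : ∀ b, l (Pi.single b 1) = vectorComponent φ ε' (δ b) (y b) := fun b => by
    rw [Fintype.linearCombination_apply_single, one_smul]
  refine ⟨l, fun b => hl b ▸ isHomogeneousVector_vectorComponent _, ?_⟩
  refine LinearMap.pi_ext' fun b => LinearMap.ext_ring ?_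
  change p (l (Pi.single b 1)) = α (Pi.single b 1)
  rw [hl, ← hp.vectorComponent_map, hy, (hα b).vectorComponent_eq]

theorem IsHomotopyInverseOn.exists_graded_lift [Finite ι] [Finite κ] [Finite ι'] [Finite κ']
    (H : IsHomotopyInverseOn J (LinearMap.range f) (LinearMap.range p) α β)
    (hα : IsGradedMap φ δ ε α) (hf : IsGradedMap φ δ' δ f) (hp : IsGradedMap φ ε' ε p)
    (hker : LinearMap.ker f ≤ J • ⊤) :
    ∃ α' β', IsGradedMap φ δ' ε' α' ∧
      IsHomotopyInverseOn J (LinearMap.ker f) (LinearMap.ker p) α' β' ∧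
      ∀ x, x - β' (α' x) ∈ J • (⊤ : Submodule (MvPolynomial σ R) (ι' → MvPolynomial σ R)) := by
  obtain ⟨α', hα', hαf⟩ := (hα.comp hf).exists_lift hp
    ((LinearMap.range_comp f α).trans_le H.map_le)
  obtain ⟨β', hβp⟩ := exists_comp_eq_of_range_le ((LinearMap.range_comp p β).trans_le H.map_le')
  exact ⟨α', β', hα', H.lift hαf hβp hker, H.sub_mem_smul_top hαf hβp hker⟩

end GradedComparison

theorem mem_idealOfVars_iff {σ R : Type*} [CommSemiring R] {p : MvPolynomial σ R} :
    p ∈ idealOfVars σ R ↔ constantCoeff p = 0 := by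
  rw [← pow_one (idealOfVars σ R), mem_pow_idealOfVars_iff']
  simp only [Nat.lt_one_iff, Finsupp.degree_eq_zero_iff, forall_eq, constantCoeff_eq]

theorem single_notMem_smul_top {σ R ι : Type*} [CommSemiring R] [Nontrivial R] [Finite ι]
    [DecidableEq ι] (a : ι) :
    Pi.single a 1 ∉ idealOfVars σ R • (⊤ : Submodule (MvPolynomial σ R)
      (ι → MvPolynomial σ R)) := fun h => by
  have h₁ := mem_idealOfVars_iff.1 (mem_smul_top_pi_iff.1 h a)
  rw [Pi.single_eq_same, map_one] at h₁
  exact one_ne_zero h₁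

namespace MinimalGradedFreeResolution

variable {K : Type*} [Field K] {n : ℕ} {I : Ideal (MvPolynomial (Fin n) K)}

theorem isGradedMap_d (F : MinimalGradedFreeResolution I) (i : ℕ) :
    IsGradedMap Finsupp.degree (F.deg (i + 1)) (F.deg i) (F.d i) := fun b =>
  IsHomogeneousVector.degree_iff.2 fun a => F.d_homogeneous i a b

theorem ker_d (F : MinimalGradedFreeResolution I) (i : ℕ) :
    LinearMap.ker (F.d i) = LinearMap.range (F.d (i + 1)) :=
  LinearMap.exact_iff.1 (F.exact_succ i)

theorem range_d_le (F : MinimalGradedFreeResolution I) (i : ℕ) :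
    LinearMap.range (F.d i) ≤ idealOfVars (Fin n) K • ⊤ := by
  rintro _ ⟨x, rfl⟩
  rw [map_eq_sum_single]
  exact Submodule.sum_mem _ fun b _ => Submodule.smul_mem _ _ <|
    mem_smul_top_pi_iff.2 fun a => mem_idealOfVars_iff.2 (F.minimal i a b)

/-- The augmentation as a map into the free module of rank `1`, so that lifting through it and
lifting through a differential are instances of the same statement. -/
noncomputable def augVector (F : MinimalGradedFreeResolution I) :
    (Fin (F.rank 0) → MvPolynomial (Fin n) K) →ₗ[MvPolynomial (Fin n) K]
      (Fin 1 → MvPolynomial (Fin n) K) :=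
  (LinearEquiv.funUnique (Fin 1) (MvPolynomial (Fin n) K) (MvPolynomial (Fin n) K)).symm ∘ₗ F.aug

theorem isGradedMap_augVector (F : MinimalGradedFreeResolution I) :
    IsGradedMap Finsupp.degree (F.deg 0) 0 F.augVector := fun b =>
  IsHomogeneousVector.degree_iff.2 fun _ _ => ⟨_, zero_add _, F.aug_homogeneous b⟩

theorem range_augVector (F : MinimalGradedFreeResolution I) :
    LinearMap.range F.augVector = Submodule.map
      (LinearEquiv.funUnique (Fin 1) _ (MvPolynomial (Fin n) K)).symm.toLinearMap I := by
  rw [augVector, LinearMap.range_comp, F.range_aug]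

theorem ker_augVector (F : MinimalGradedFreeResolution I) :
    LinearMap.ker F.augVector = LinearMap.range (F.d 0) := by
  rw [augVector, LinearEquiv.ker_comp, LinearMap.exact_iff.1 F.exact_zero]

theorem exists_comparison (F P : MinimalGradedFreeResolution I) (i : ℕ) :
    ∃ α β, IsGradedMap Finsupp.degree (F.deg i) (P.deg i) α ∧
      IsHomotopyInverseOn (idealOfVars (Fin n) K) (LinearMap.range (F.d i))
        (LinearMap.range (P.d i)) α β ∧
      ∀ x, x - β (α x) ∈ idealOfVars (Fin n) K •
        (⊤ : Submodule (MvPolynomial (Fin n) K) (Fin (F.rank i) → MvPolynomial (Fin n) K)) := by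
  induction i with
  | zero =>
    have hid : IsHomotopyInverseOn (idealOfVars (Fin n) K) (LinearMap.range F.augVector)
        (LinearMap.range P.augVector) .id .id :=
      { map_le := by rw [Submodule.map_id, F.range_augVector, P.range_augVector]
        map_le' := by rw [Submodule.map_id, F.range_augVector, P.range_augVector]
        exists_homotopy := ⟨0, by simp⟩ }
    have hgraded : IsGradedMap Finsupp.degree (0 : Fin 1 → ℕ) (0 : Fin 1 → ℕ)
        (LinearMap.id (R := MvPolynomial (Fin n) K)) := fun b => by
      refine IsHomogeneousVector.degree_iff.2 fun a _ => ⟨0, rfl, ?_⟩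
      rw [Subsingleton.elim a b, LinearMap.id_apply, Pi.single_eq_same]
      exact isHomogeneous_one _ _
    simpa only [ker_augVector] using hid.exists_graded_lift hgraded F.isGradedMap_augVector
      P.isGradedMap_augVector (F.ker_augVector.trans_le (F.range_d_le 0))
  | succ i ih =>
    obtain ⟨α, β, hα, h, -⟩ := ih
    simpa only [ker_d] using h.exists_graded_lift hα (F.isGradedMap_d i) (P.isGradedMap_d i)
      ((F.ker_d i).trans_le (F.range_d_le (i + 1)))

theorem exists_deg_eq (F P : MinimalGradedFreeResolution I) (i : ℕ) (a : Fin (F.rank i)) :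
    ∃ b, P.deg i b = F.deg i a := by
  obtain ⟨α, β, hα, -, hβα⟩ := F.exists_comparison P i
  by_contra! hne
  have hα₀ : α (Pi.single a 1) ∈ idealOfVars (Fin n) K •
      (⊤ : Submodule (MvPolynomial (Fin n) K) (Fin (P.rank i) → MvPolynomial (Fin n) K)) :=
    mem_smul_top_pi_iff.2 fun b => mem_idealOfVars_iff.2 <| by_contra fun h =>
      hne b (by simpa using hα a b 0 h)
  have hβα₀ : β (α (Pi.single a 1)) ∈ idealOfVars (Fin n) K •
      (⊤ : Submodule (MvPolynomial (Fin n) K) (Fin (F.rank i) → MvPolynomial (Fin n) K)) :=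
    Submodule.smul_mono le_rfl le_top ((Submodule.map_smul'' _ _ β).le ⟨_, hα₀, rfl⟩)
  exact single_notMem_smul_top a ((Submodule.sub_mem_iff_left _ hβα₀).1 (hβα _))

theorem exists_deg_lt (F : MinimalGradedFreeResolution I) (i : ℕ) (b : Fin (F.rank (i + 1))) :
    ∃ a, F.deg i a < F.deg (i + 1) b := by
  have hne : F.d i (Pi.single b 1) ≠ 0 := fun h =>
    single_notMem_smul_top b (F.range_d_le (i + 1) ((F.ker_d i).le h))
  obtain ⟨a, ha⟩ := Function.ne_iff.1 hne
  obtain ⟨e, he⟩ := exists_coeff_ne_zero ha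
  have hdeg : F.deg i a + e.degree = F.deg (i + 1) b := F.isGradedMap_d i b a e he
  have he₀ : e.degree ≠ 0 := fun h =>
    he ((Finsupp.degree_eq_zero_iff e).1 h ▸ F.minimal i a b)
  exact ⟨a, by omega⟩

theorem exists_coeff_ne_zero_degree_eq (F : MinimalGradedFreeResolution I) (b : Fin (F.rank 0)) :
    ∃ p ∈ I, ∃ e, coeff e p ≠ 0 ∧ e.degree = F.deg 0 b := by
  have hne : F.augVector (Pi.single b 1) ≠ 0 := fun h =>
    single_notMem_smul_top b (F.range_d_le 0 (F.ker_augVector.le h))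
  obtain ⟨a, ha⟩ := Function.ne_iff.1 hne
  obtain ⟨e, he⟩ := exists_coeff_ne_zero ha
  exact ⟨_, F.range_aug.le ⟨_, rfl⟩, e, he,
    (zero_add _).symm.trans (F.isGradedMap_augVector b a e he)⟩

theorem add_le_deg {d : ℕ} (hI : I ≤ idealOfVars (Fin n) K ^ d)
    (F : MinimalGradedFreeResolution I) (i : ℕ) (b : Fin (F.rank i)) : d + i ≤ F.deg i b := by
  induction i with
  | zero =>
    obtain ⟨p, hp, e, he, hdeg⟩ := F.exists_coeff_ne_zero_degree_eq b
    rw [add_zero, ← hdeg]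
    exact not_lt.1 fun h => he ((mem_pow_idealOfVars_iff' _ _).1 (hI hp) e h)
  | succ i ih =>
    obtain ⟨a, ha⟩ := F.exists_deg_lt i b
    exact (ih a).trans_lt ha

theorem rank_zero_ne_zero (hI : I ≠ ⊥) (F : MinimalGradedFreeResolution I) : F.rank 0 ≠ 0 :=
  fun h => hI <| by
    have : IsEmpty (Fin (F.rank 0)) := by rw [h]; infer_instance
    rw [← F.range_aug, Subsingleton.elim F.aug 0, LinearMap.range_zero]

theorem betti_ne_zero_iff (F : MinimalGradedFreeResolution I) {i j : ℕ} :
    F.betti i j ≠ 0 ↔ ∃ a, F.deg i a = j := by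
  rw [betti, ← Nat.pos_iff_ne_zero, Fintype.card_pos_iff, nonempty_subtype]

end MinimalGradedFreeResolution

/-! ### Projective dimension -/

section ProjectiveDimension

open CategoryTheory

universe u

theorem hasProjectiveDimensionLT_range {R : Type u} [CommRing R] {M N : Type u} [AddCommGroup M]
    [AddCommGroup N] [Module R M] [Module R N] [Module.Projective R M] (f : M →ₗ[R] N) (m : ℕ)
    (h : HasProjectiveDimensionLT (ModuleCat.of R (LinearMap.ker f)) m) :
    HasProjectiveDimensionLT (ModuleCat.of R (LinearMap.range f)) (m + 1) := by
  let S : ShortComplex (ModuleCat.{u} R) :=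
    ShortComplex.mk (ModuleCat.ofHom (LinearMap.ker f).subtype) (ModuleCat.ofHom f.rangeRestrict)
      (ModuleCat.hom_ext (LinearMap.ext fun x => Subtype.ext x.2))
  have hexact : Function.Exact (LinearMap.ker f).subtype f.rangeRestrict :=
    LinearMap.exact_iff.2 (by rw [LinearMap.ker_rangeRestrict, Submodule.range_subtype])
  have hS : S.ShortExact := ModuleCat.shortComplex_shortExact S hexact
    (LinearMap.ker f).injective_subtype f.surjective_rangeRestrict
  have hM : Projective (ModuleCat.of R M) := (IsProjective.iff_projective M).1 inferInstance
  exact hS.hasProjectiveDimensionLT_X₃ m h (inferInstanceAs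
    (HasProjectiveDimensionLT (ModuleCat.of R M) (m + 1)))

namespace MinimalGradedFreeResolution

variable {K : Type u} [Field K] {n : ℕ} {I : Ideal (MvPolynomial (Fin n) K)}

theorem hasProjectiveDimensionLT_range_d (F : MinimalGradedFreeResolution I) (m i : ℕ)
    (h : F.rank (i + 1 + m) = 0) :
    HasProjectiveDimensionLT (ModuleCat.of (MvPolynomial (Fin n) K) (LinearMap.range (F.d i)))
      m := by
  induction m generalizing i with
  | zero =>
    have : IsEmpty (Fin (F.rank (i + 1))) := by rw [h]; infer_instance
    rw [hasProjectiveDimensionLT_zero_iff_isZero, Subsingleton.elim (F.d i) 0,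
      LinearMap.range_zero]
    exact ModuleCat.isZero_of_subsingleton _
  | succ m ih =>
    refine hasProjectiveDimensionLT_range (F.d i) m ?_
    rw [F.ker_d]
    exact ih (i + 1) (by rwa [add_right_comm (i + 1) 1 m])

theorem projectiveDimension_le (F : MinimalGradedFreeResolution I) {m : ℕ}
    (h : F.rank (m + 1) = 0) :
    projectiveDimension (ModuleCat.of (MvPolynomial (Fin n) K) I) ≤ m := by
  have hd := F.hasProjectiveDimensionLT_range_d m 0 (by rwa [zero_add, add_comm])
  rw [← LinearMap.exact_iff.1 F.exact_zero] at hd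
  have haug := hasProjectiveDimensionLT_range F.aug m hd
  rw [F.range_aug] at haug
  exact (projectiveDimension_le_iff _ m).2 haug

end MinimalGradedFreeResolution

theorem exists_eq_mul_of_projective {R : Type*} [CommRing R] {I : Ideal R} [Module.Projective R I]
    {p x y a b : R} (hp : Prime p) (hx : x ∈ I) (hy : y ∈ I) (h : a * x = b * y) (ha : ¬ p ∣ a)
    (hb : p ∣ b) : ∃ z ∈ I, x = p * z := by
  obtain ⟨s, hs⟩ := (Module.projective_def' (R := R) (P := I)).1 inferInstance
  -- The section `s` embeds `I` in a free module, where `p` divides the coordinates of `x`.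
  have hdvd : ∀ k, p ∣ s ⟨x, hx⟩ k := fun k => by
    have hsmul : a • s ⟨x, hx⟩ = b • s ⟨y, hy⟩ := by
      rw [← map_smul, ← map_smul]
      exact congrArg s (Subtype.ext h)
    have hmul : a * s ⟨x, hx⟩ k = b * s ⟨y, hy⟩ k := DFunLike.congr_fun hsmul k
    exact (hp.dvd_or_dvd (hmul ▸ hb.mul_right _)).resolve_left ha
  choose c hc using hdvd
  have hsum : ∑ k ∈ (s ⟨x, hx⟩).support, s ⟨x, hx⟩ k * k = x := by
    have := congrArg Subtype.val (LinearMap.congr_fun hs ⟨x, hx⟩)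
    rwa [LinearMap.comp_apply, Finsupp.linearCombination_apply, Finsupp.sum,
      Submodule.coe_sum] at this
  refine ⟨∑ k ∈ (s ⟨x, hx⟩).support, c k * k,
    Ideal.sum_mem _ fun k _ => I.mul_mem_left _ k.2, ?_⟩
  simp only [Finset.mul_sum, ← mul_assoc, ← hc, hsum]

theorem not_projective_of_monomial_mem {σ R : Type*} [CommRing R] [IsDomain R]
    {I : Ideal (MvPolynomial σ R)} {d : ℕ} (hI : I ≤ idealOfVars σ R ^ d) {u w : σ →₀ ℕ}
    (huw : u ≠ w) (hu : u.degree = d) (hw : w.degree = d) (huI : monomial u 1 ∈ I)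
    (hwI : monomial w 1 ∈ I) : ¬ Module.Projective (MvPolynomial σ R) I := fun _ => by
  classical
  obtain ⟨k, hk⟩ : ∃ k, w k < u k := by
    by_contra! hle
    obtain ⟨v, rfl⟩ := exists_add_of_le (show u ≤ w from hle)
    rw [map_add, hu, add_eq_left, Finsupp.degree_eq_zero_iff] at hw
    exact huw (by rw [hw, add_zero])
  have hlcm : w - u + u = u - w + w := Finsupp.ext fun i => by
    simp only [Finsupp.add_apply, Finsupp.tsub_apply]
    omega
  obtain ⟨z, hz, huz⟩ := exists_eq_mul_of_projective (X_prime (i := k)) huI hwI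
    (a := monomial (w - u) 1) (b := monomial (u - w) 1)
    (by rw [monomial_mul, monomial_mul, hlcm])
    (by simp [X_dvd_monomial, hk.le]) (by simp [X_dvd_monomial, Nat.sub_ne_zero_of_lt hk])
  obtain ⟨v, rfl⟩ := exists_add_of_le
    (Finsupp.single_le_iff.2 (Nat.one_le_of_lt hk) : Finsupp.single k 1 ≤ u)
  have hv : v.degree < d := by
    rw [← hu, map_add, Finsupp.degree_single]
    omega
  have hzv : coeff v z = 1 := by rw [← coeff_X_mul, ← huz, coeff_monomial, if_pos rfl]
  exact one_ne_zero (hzv.symm.trans ((mem_pow_idealOfVars_iff' _ _).1 (hI hz) v hv))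

theorem one_le_projectiveDimension_iff {R : Type u} [CommRing R] {M : Type u} [AddCommGroup M]
    [Module R M] :
    1 ≤ projectiveDimension (ModuleCat.of R M) ↔ ¬ Module.Projective R M := by
  rw [IsProjective.iff_projective, projective_iff_hasProjectiveDimensionLT_one]
  exact_mod_cast projectiveDimension_ge_iff (ModuleCat.of R M) 1

end ProjectiveDimension

/-! ### Squarefree monomial ideals generated in one degree -/

theorem monomialIdeal_le_idealOfVars_pow {σ R : Type*} [CommSemiring R] {A : Set (σ →₀ ℕ)}
    {d : ℕ} (hA : ∀ u ∈ A, u.degree = d) : monomialIdeal R A ≤ idealOfVars σ R ^ d := by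
  rw [monomialIdeal, pow_idealOfVars_eq_span]
  exact Ideal.span_mono (Set.image_mono hA)

namespace MinimalGradedFreeResolution

variable {K : Type*} [Field K] {n d : ℕ} {A : Set (Fin n →₀ ℕ)}

theorem deg_le_of_squarefree (hA : ∀ u ∈ A, ∀ k, u k ≤ 1)
    (F : MinimalGradedFreeResolution (monomialIdeal K A)) (i : ℕ) (a : Fin (F.rank i)) :
    F.deg i a ≤ n := by
  obtain ⟨P, hP, -⟩ := exists_deg_le_of_squarefree (K := K) hA
  obtain ⟨b, hb⟩ := F.exists_deg_eq P i a
  exact hb ▸ hP i b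

theorem exists_deg_zero_eq_degree (hA : ∀ u ∈ A, ∀ k, u k ≤ 1)
    (F : MinimalGradedFreeResolution (monomialIdeal K A)) (a : Fin (F.rank 0)) :
    ∃ u ∈ A, F.deg 0 a = u.degree := by
  obtain ⟨P, -, hP⟩ := exists_deg_le_of_squarefree (K := K) hA
  obtain ⟨b, hb⟩ := F.exists_deg_eq P 0 a
  exact hb ▸ hP b

theorem betti_ne_zero_of_squarefree (hA : ∀ u ∈ A, ∀ k, u k ≤ 1)
    (hd : ∀ u ∈ A, u.degree = d) (F : MinimalGradedFreeResolution (monomialIdeal K A)) {i j : ℕ}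
    (h : F.betti i j ≠ 0) : d + i ≤ j ∧ j ≤ n ∧ (i = 0 → j = d) := by
  obtain ⟨a, rfl⟩ := F.betti_ne_zero_iff.1 h
  refine ⟨F.add_le_deg (monomialIdeal_le_idealOfVars_pow hd) i a, F.deg_le_of_squarefree hA i a, ?_⟩
  rintro rfl
  obtain ⟨u, hu, h⟩ := F.exists_deg_zero_eq_degree hA a
  exact h.trans (hd u hu)

theorem projectiveDimension_le_of_squarefree {m : ℕ} (hA : ∀ u ∈ A, ∀ k, u k ≤ 1)
    (hd : ∀ u ∈ A, u.degree = d) (hm : n ≤ d + m) :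
    CategoryTheory.projectiveDimension (ModuleCat.of (MvPolynomial (Fin n) K)
      (monomialIdeal K A)) ≤ m := by
  obtain ⟨P, hP, -⟩ := exists_deg_le_of_squarefree (K := K) hA
  refine P.projectiveDimension_le (Nat.eq_zero_of_not_pos fun hpos => ?_)
  have := P.add_le_deg (monomialIdeal_le_idealOfVars_pow hd) (m + 1) ⟨0, hpos⟩
  have := hP (m + 1) ⟨0, hpos⟩
  omega

theorem exists_isRegularity_of_squarefree (hA : ∀ u ∈ A, ∀ k, u k ≤ 1)
    (hd : ∀ u ∈ A, u.degree = d) (hne : A.Nonempty)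
    (F : MinimalGradedFreeResolution (monomialIdeal K A)) :
    ∃ r : ℤ, F.IsRegularity r ∧ d ≤ r ∧ r ≤ max (d : ℤ) ((n : ℤ) - 1) := by
  have hrank : F.rank 0 ≠ 0 := F.rank_zero_ne_zero fun hbot => by
    obtain ⟨u, hu⟩ := hne
    have hmem : monomial u (1 : K) ∈ monomialIdeal K A := Ideal.subset_span ⟨u, hu, rfl⟩
    rw [hbot, Ideal.mem_bot, monomial_eq_zero] at hmem
    exact one_ne_zero hmem
  let a : Fin (F.rank 0) := ⟨0, Nat.pos_of_ne_zero hrank⟩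
  obtain ⟨u, hu, ha⟩ := F.exists_deg_zero_eq_degree hA a
  have hmem : ∃ i j : ℕ, F.betti i j ≠ 0 ∧ (d : ℤ) = j - i :=
    ⟨0, d, F.betti_ne_zero_iff.2 ⟨a, ha.trans (hd u hu)⟩, by simp⟩
  have hle : ∀ s : ℤ, (∃ i j : ℕ, F.betti i j ≠ 0 ∧ s = j - i) → s ≤ max (d : ℤ) ((n : ℤ) - 1) := by
    rintro s ⟨i, j, h, rfl⟩
    have := F.betti_ne_zero_of_squarefree hA hd h
    omega
  obtain ⟨r, hr⟩ := BddAbove.exists_isGreatest_of_nonempty ⟨_, hle⟩ ⟨_, hmem⟩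
  exact ⟨r, hr, hr.2 hmem, hle r hr.1⟩

end MinimalGradedFreeResolution

/-! ### Complementary edge ideals -/

theorem sum_single_one_apply {σ : Type*} [DecidableEq σ] (s : Finset σ) (k : σ) :
    (∑ i ∈ s, Finsupp.single i 1 : σ →₀ ℕ) k = if k ∈ s then 1 else 0 := by
  simp [Finsupp.finsetSum_apply, Finsupp.single_apply]

theorem sum_single_one_injective (σ : Type*) :
    Function.Injective fun s : Finset σ => (∑ i ∈ s, Finsupp.single i 1 : σ →₀ ℕ) := by
  classical
  intro s t h
  ext k
  have hk := DFunLike.congr_fun h k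
  simp only [sum_single_one_apply] at hk
  grind

section ComplementaryEdgeIdeal

variable {n : ℕ} (G : SimpleGraph (Fin n))

/-- The exponents of the generators of the complementary edge ideal of `G`. -/
def complementaryEdgeExponents : Set (Fin n →₀ ℕ) :=
  {u | ∃ i j, G.Adj i j ∧ u = ∑ k ∈ ({i, j} : Finset (Fin n))ᶜ, Finsupp.single k 1}

theorem complementaryEdgeIdeal_eq_monomialIdeal (K : Type*) [Field K] :
    complementaryEdgeIdeal K G = monomialIdeal K (complementaryEdgeExponents G) := by
  refine congrArg Ideal.span (Set.ext fun p => ⟨?_, ?_⟩)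
  · rintro ⟨i, j, h, rfl⟩
    exact ⟨_, ⟨i, j, h, rfl⟩, monomial_sum_one _ _⟩
  · rintro ⟨_, ⟨i, j, h, rfl⟩, rfl⟩
    exact ⟨i, j, h, monomial_sum_one _ _⟩

variable {G}

theorem le_one_of_mem_complementaryEdgeExponents {u : Fin n →₀ ℕ}
    (hu : u ∈ complementaryEdgeExponents G) (k : Fin n) : u k ≤ 1 := by
  obtain ⟨i, j, -, rfl⟩ := hu
  rw [sum_single_one_apply]
  split_ifs <;> simp

theorem degree_of_mem_complementaryEdgeExponents {u : Fin n →₀ ℕ}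
    (hu : u ∈ complementaryEdgeExponents G) : u.degree = n - 2 := by
  obtain ⟨i, j, h, rfl⟩ := hu
  rw [map_sum, Finset.sum_congr rfl fun k _ => Finsupp.degree_single k 1,
    ← Finset.card_eq_sum_ones, Finset.card_compl, Fintype.card_fin, Finset.card_pair h.ne]

theorem nontrivial_complementaryEdgeExponents (hG : G.edgeSet.Nontrivial) :
    (complementaryEdgeExponents G).Nontrivial := by
  obtain ⟨⟨i, j⟩, hij, ⟨k, l⟩, hkl, hne⟩ := hG
  refine ⟨_, ⟨i, j, hij, rfl⟩, _, ⟨k, l, hkl, rfl⟩, fun h => hne ?_⟩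
  have hpair := Finset.coe_inj.2 (compl_injective (sum_single_one_injective _ h))
  rwa [Finset.coe_pair, Finset.coe_pair, Set.pair_eq_pair_iff, ← Sym2.eq_iff] at hpair

theorem edgeSet_nontrivial_of_forall_exists_adj (hn : 3 ≤ n) (hG : ∀ v, ∃ w, G.Adj v w) :
    G.edgeSet.Nontrivial := by
  let z : Fin n := ⟨0, by omega⟩
  obtain ⟨w, hw⟩ := hG z
  obtain ⟨v, hvz, hvw⟩ := Fin.exists_ne_and_ne_of_two_lt z w hn
  obtain ⟨x, hx⟩ := hG v
  refine ⟨s(z, w), hw, s(v, x), hx, fun h => ?_⟩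
  exact (Sym2.mem_iff.1 (h ▸ Sym2.mem_mk_left v x)).elim hvz hvw

end ComplementaryEdgeIdeal

theorem proposition3p1_general {K : Type*} [Field K] {n : ℕ} (G : SimpleGraph (Fin n)) :
    Nonempty (MinimalGradedFreeResolution (complementaryEdgeIdeal K G)) ∧
    (∀ (F : MinimalGradedFreeResolution (complementaryEdgeIdeal K G)) (i j : ℕ),
      F.betti i j ≠ 0 →
        (i, j) ∈ ({(0, n - 2), (1, n - 1), (1, n), (2, n)} : Set (ℕ × ℕ))) ∧
    CategoryTheory.projectiveDimension
      (ModuleCat.of (MvPolynomial (Fin n) K) (complementaryEdgeIdeal K G)) ≤ 2 ∧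
    (G.edgeSet.Nontrivial → 1 ≤ CategoryTheory.projectiveDimension
      (ModuleCat.of (MvPolynomial (Fin n) K) (complementaryEdgeIdeal K G))) ∧
    (G.edgeSet.Nonempty → ∀ F : MinimalGradedFreeResolution (complementaryEdgeIdeal K G),
      ∃ r : ℤ, F.IsRegularity r ∧ (n : ℤ) - 2 ≤ r ∧ r ≤ (n : ℤ) - 1) := by
  have hA : ∀ u ∈ complementaryEdgeExponents G, ∀ k, u k ≤ 1 := fun _ =>
    le_one_of_mem_complementaryEdgeExponents
  have hd : ∀ u ∈ complementaryEdgeExponents G, u.degree = n - 2 := fun _ =>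
    degree_of_mem_complementaryEdgeExponents
  rw [complementaryEdgeIdeal_eq_monomialIdeal]
  refine ⟨?_, fun F i j h => ?_, ?_, fun hG => ?_, fun hG F => ?_⟩
  · obtain ⟨P, -⟩ := MinimalGradedFreeResolution.exists_deg_le_of_squarefree (K := K) hA
    exact ⟨P⟩
  · have := F.betti_ne_zero_of_squarefree hA hd h
    simp only [Set.mem_insert_iff, Set.mem_singleton_iff, Prod.mk.injEq]
    omega
  · exact MinimalGradedFreeResolution.projectiveDimension_le_of_squarefree (m := 2) hA hd (by omega)
  · obtain ⟨u, hu, w, hw, huw⟩ := nontrivial_complementaryEdgeExponents hG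
    exact one_le_projectiveDimension_iff.2 <| not_projective_of_monomial_mem
      (monomialIdeal_le_idealOfVars_pow hd) huw (hd u hu) (hd w hw)
      (Ideal.subset_span ⟨u, hu, rfl⟩) (Ideal.subset_span ⟨w, hw, rfl⟩)
  · obtain ⟨⟨i, j⟩, hij⟩ := hG
    obtain ⟨r, hr, hle, hge⟩ := F.exists_isRegularity_of_squarefree hA hd ⟨_, i, j, hij, rfl⟩
    have hij' : (i : ℕ) ≠ j := Fin.val_ne_of_ne (G.ne_of_adj hij)
    exact ⟨r, hr, by omega, by omega⟩

theorem proposition3p1 {K : Type*} [Field K] {n : ℕ} (hn : 4 ≤ n) (G : SimpleGraph (Fin n)) :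
    Nonempty (MinimalGradedFreeResolution (complementaryEdgeIdeal K G)) ∧
    (∀ (F : MinimalGradedFreeResolution (complementaryEdgeIdeal K G)) (i j : ℕ),
      F.betti i j ≠ 0 →
        (i, j) ∈ ({(0, n - 2), (1, n - 1), (1, n), (2, n)} : Set (ℕ × ℕ))) ∧
    ((∀ v, ∃ w, G.Adj v w) →
      (1 ≤ CategoryTheory.projectiveDimension
          (ModuleCat.of (MvPolynomial (Fin n) K) (complementaryEdgeIdeal K G)) ∧
        CategoryTheory.projectiveDimension
          (ModuleCat.of (MvPolynomial (Fin n) K) (complementaryEdgeIdeal K G)) ≤ 2) ∧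
      ∀ F : MinimalGradedFreeResolution (complementaryEdgeIdeal K G),
        ∃ r : ℤ, F.IsRegularity r ∧ (n : ℤ) - 2 ≤ r ∧ r ≤ (n : ℤ) - 1) := by
  obtain ⟨hres, hbetti, hle, hge, hreg⟩ := proposition3p1_general (K := K) G
  exact ⟨hres, hbetti, fun hG =>
    have hE := edgeSet_nontrivial_of_forall_exists_adj (by omega) hG
    ⟨⟨hge hE, hle⟩, hreg hE.nonempty⟩⟩
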